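/- Let $\Omega\subset\mathbb{R}^3$ be a bounded open set and let $\mathcal T$ be a conforming tetrahedral mesh of $\overline\Omega$, that is, a finite simplicial complex in $\mathbb{R}^3$ with underlying space $\overline{\Omega}$ in which every simplex is a face of a (nondegenerate, closed) tetrahedron of the complex. Let $v_1,\dots,v_V$ be its vertices. For a vertex $v_i$ let $e_i$ be the number of edges of $\mathcal T$ containing $v_i$, let $\omega(v_i)$ be the set of tetrahedra of $\mathcal T$ containing $v_i$, and let $t_i=\#\omega(v_i)$. For $\tau\in\omega(v_i)$ let $\alpha_{\tau,i}$ be the solid angle of $\tau$ at $v_i$, i.e. the area of the set of unit vectors pointing from $v_i$ into $\tau$. Put $$\overline\alpha_i=\frac1{t_i}\sum_{\tau\in\omega(v_i)}\alpha_{\tau,i},\qquad \alpha_i=\min_{\tau\in\omega(v_i)}\alpha_{\tau,i},\qquad \alpha_{\mathcal T}=\min_{1\le i\le V}\alpha_i .$$ Then for every interior vertex $v_i$, i.e. every vertex $v_i\notin\partial\Omega$, $$e_i = 2+\frac{2\pi}{\overline\alpha_i}\;\le\; 2+\frac{2\pi}{\alpha_i}\;\le\; 2+\frac{2\pi}{\alpha_{\mathcal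 T}} .$$ -/

import Mathlib

/-- Euclidean three-space. -/
abbrev E3 : Type := EuclideanSpace ℝ (Fin 3)

/-- `K` is a conforming tetrahedral mesh of the closure of `Ω`: a finite simplicial complex (given by
the vertex sets of its simplices) which is pure of dimension three and whose underlying space is the
closure of `Ω`. -/
structure IsTetrahedralMesh (K : Geometry.SimplicialComplex ℝ E3) (Ω : Set E3) : Prop where
  finite : K.faces.Finite
  pure : ∀ s ∈ K.faces, ∃ τ ∈ K.faces, s ⊆ τ ∧ τ.card = 4
  space_eq : K.space = closure Ω

/-- The edges of the mesh emanating from `v`. -/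
def vertexEdges (K : Geometry.SimplicialComplex ℝ E3) (v : E3) : Set (Finset E3) :=
  {s | s ∈ K.faces ∧ s.card = 2 ∧ v ∈ s}

/-- The star of `v`: the tetrahedra of the mesh having `v` as a vertex. -/
def vertexStar (K : Geometry.SimplicialComplex ℝ E3) (v : E3) : Set (Finset E3) :=
  {τ | τ ∈ K.faces ∧ τ.card = 4 ∧ v ∈ τ}

/-- The solid angle at the apex `v` of the simplex with vertex set `τ`: the surface area of the set of
unit vectors which point from `v` into the simplex. -/
noncomputable def solidAngle (τ : Finset E3) (v : E3) : ℝ :=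
  (MeasureTheory.volume : MeasureTheory.Measure E3).toSphere.real
    {u : Metric.sphere (0 : E3) 1 |
      ∃ r : ℝ, 0 < r ∧ v + r • (u : E3) ∈ convexHull ℝ (τ : Set E3)}

/-- The mean solid angle at `v` (the star of `v` is finite for a mesh). -/
noncomputable def meanSolidAngle (K : Geometry.SimplicialComplex ℝ E3) (v : E3) : ℝ :=
  (1 / ((vertexStar K v).ncard : ℝ)) * ∑ᶠ τ ∈ vertexStar K v, solidAngle τ v

/-- The minimal solid angle at `v`; for a vertex of a mesh the infimum is over a finite nonempty set,
hence a minimum. -/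
noncomputable def minSolidAngleAt (K : Geometry.SimplicialComplex ℝ E3) (v : E3) : ℝ :=
  sInf ((fun τ => solidAngle τ v) '' vertexStar K v)

/-- The minimal solid angle in the mesh; the infimum is over the finite set of vertices, hence a
minimum. -/
noncomputable def minSolidAngle (K : Geometry.SimplicialComplex ℝ E3) : ℝ :=
  sInf (minSolidAngleAt K '' K.vertices)

/-!
Write `e` for the number of edges and `t` for the number of tetrahedra at the interior vertex `v`. The
solid angles at `v` add up to `4 * π` (`finsum_solidAngle`), so their mean is `4 * π / t`, and the
claimed identity is `e = 2 + t / 2`, which is Euler's relation for the link of `v`. The inequalities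
only say that a minimum over finitely many positive numbers is positive and at most the mean.

Euler's relation (`two_mul_ncard_vertexEdges`) is obtained by a discrete form of Legendre's argument
with spherical excess, the area measure being replaced by the two point masses at `x` and `-x` for a
direction `x` in general position. A tetrahedron `τ` and a face `f` of it span a wedge: the directions
along which the barycentric coordinates of `τ` at its vertices outside `f` increase. For `f = {v}` the
wedge is the cone of `τ` at `v`, and for an edge `f = {v, u}` it is the dihedral wedge along that edge.
Since `v` is an interior point of the mesh, and so are the points of each edge close to `v`, the wedges
around any such `f` tile the space: each generic direction is in exactly one of them
(`exists_tetrahedron_of_direction`, `eq_of_direction_mem_wedges`). Hence the pairs consisting of an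
edge wedge at `v` and one of `x`, `-x` lying in it number `2 * e`. Counted by tetrahedra, `τ` contributes
`3` if `x` or `-x` is in its cone at `v` and `1` otherwise, by inspection of the signs of its three
coordinates (`card_filter_pos_add_card_filter_neg`). Exactly one tetrahedron has `x` in its cone and
exactly one has `-x`, so the total is `t + 4`.
-/

open Geometry Filter Topology MeasureTheory

/-! ### Barycentric coordinates in a tetrahedron -/

/-- The barycentric coordinate of the vertex `i` with respect to the tetrahedron `τ`, as an affine
function on the whole space. The value is the zero function unless `τ` is a nondegenerate
tetrahedron and `i` one of its vertices. -/
noncomputable def baryCoord (τ : Finset E3) (i : E3) : E3 →ᵃ[ℝ] ℝ :=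
  open Classical in
  if h : (AffineIndependent ℝ ((↑) : τ → E3) ∧ affineSpan ℝ (Set.range ((↑) : τ → E3)) = ⊤) ∧ i ∈ τ
  then (AffineBasis.mk ((↑) : τ → E3) h.1.1 h.1.2).coord ⟨i, h.2⟩ else 0

section Tetrahedron

variable {τ : Finset E3}

theorem exists_affineBasis_of_card (hi : AffineIndependent ℝ ((↑) : τ → E3)) (hc : τ.card = 4) :
    ∃ b : AffineBasis τ ℝ E3, (b : τ → E3) = (↑) ∧ ∀ i : τ, baryCoord τ i = b.coord i := by
  have ht : affineSpan ℝ (Set.range ((↑) : τ → E3)) = ⊤ := by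
    rw [hi.affineSpan_eq_top_iff_card_eq_finrank_add_one]
    simp [hc]
  exact ⟨⟨_, hi, ht⟩, rfl, fun i => by rw [baryCoord, dif_pos ⟨⟨hi, ht⟩, i.2⟩]⟩

theorem baryCoord_apply (hi : AffineIndependent ℝ ((↑) : τ → E3)) (hc : τ.card = 4)
    {i j : E3} (hiτ : i ∈ τ) (hjτ : j ∈ τ) : baryCoord τ i j = if i = j then 1 else 0 := by
  classical
  obtain ⟨b, hb, h⟩ := exists_affineBasis_of_card hi hc
  have := b.coord_apply ⟨i, hiτ⟩ ⟨j, hjτ⟩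
  rw [hb] at this
  rw [h ⟨i, hiτ⟩, this]
  simp

theorem mem_convexHull_iff_baryCoord_nonneg (hi : AffineIndependent ℝ ((↑) : τ → E3))
    (hc : τ.card = 4) {x : E3} :
    x ∈ convexHull ℝ (τ : Set E3) ↔ ∀ i ∈ τ, 0 ≤ baryCoord τ i x := by
  obtain ⟨b, hb, h⟩ := exists_affineBasis_of_card hi hc
  have := b.convexHull_eq_nonneg_coord
  rw [hb] at this
  simp only [Subtype.range_coe_subtype, Finset.setOfPred_mem] at this
  rw [this]
  exact ⟨fun hx i hiτ => by rw [h ⟨i, hiτ⟩]; exact hx _,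
    fun hx i => by rw [← h i]; exact hx i i.2⟩

theorem baryCoord_eq_zero_of_mem_convexHull (hi : AffineIndependent ℝ ((↑) : τ → E3))
    (hc : τ.card = 4) {s : Set E3} (hs : s ⊆ τ) {x : E3} (hx : x ∈ convexHull ℝ s)
    {i : E3} (hiτ : i ∈ τ) (his : i ∉ s) : baryCoord τ i x = 0 := by
  have hconv : Convex ℝ (baryCoord τ i ⁻¹' {0}) := (convex_singleton 0).affine_preimage _
  refine convexHull_min (fun j hj => ?_) hconv hx
  have hne : i ≠ j := fun h => his (h ▸ hj)
  simp [baryCoord_apply hi hc hiτ (hs hj), hne]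

theorem continuous_baryCoord (τ : Finset E3) (i : E3) : Continuous (baryCoord τ i) :=
  (baryCoord τ i).continuous_of_finiteDimensional

theorem baryCoord_add_smul (τ : Finset E3) (i p x : E3) (r : ℝ) :
    baryCoord τ i (p + r • x) = baryCoord τ i p + r * (baryCoord τ i).linear x := by
  have := (baryCoord τ i).map_vadd p (r • x)
  rw [vadd_eq_add, add_comm] at this
  rw [this]
  simp [add_comm]

theorem baryCoord_linear_sub (τ : Finset E3) (i x y : E3) :
    (baryCoord τ i).linear (x - y) = baryCoord τ i x - baryCoord τ i y :=
  (baryCoord τ i).linearMap_vsub x y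

theorem baryCoord_linear_ne_zero (hi : AffineIndependent ℝ ((↑) : τ → E3)) (hc : τ.card = 4)
    {i : E3} (hiτ : i ∈ τ) : (baryCoord τ i).linear ≠ 0 := by
  obtain ⟨j, hj, hji⟩ := Finset.exists_mem_ne (by omega : 1 < τ.card) i
  intro h
  have := baryCoord_linear_sub τ i i j
  simp [h, baryCoord_apply hi hc hiτ hiτ, baryCoord_apply hi hc hiτ hj, hji.symm] at this

/-- Barycentric coordinates that vanish at `p` are nonnegative along a ray issuing into `τ`. -/
theorem linear_nonneg_of_mem_convexHull (hi : AffineIndependent ℝ ((↑) : τ → E3))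
    (hc : τ.card = 4) {p x : E3} {r : ℝ} (hr : 0 < r)
    (hx : p + r • x ∈ convexHull ℝ (τ : Set E3)) {i : E3} (hiτ : i ∈ τ)
    (hp : baryCoord τ i p = 0) : 0 ≤ (baryCoord τ i).linear x := by
  have := (mem_convexHull_iff_baryCoord_nonneg hi hc).1 hx i hiτ
  rw [baryCoord_add_smul, hp, zero_add] at this
  exact nonneg_of_mul_nonneg_right this hr

theorem tendsto_add_smul (p x : E3) : Tendsto (fun r : ℝ => p + r • x) (𝓝[>] 0) (𝓝 p) := by
  have : Continuous fun r : ℝ => p + r • x := by fun_prop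
  simpa using (this.tendsto 0).mono_left nhdsWithin_le_nhds

/-- A ray issuing from a point `p` of `τ` starts inside `τ` as soon as the barycentric coordinates
vanishing at `p` do not decrease along it. -/
theorem eventually_mem_convexHull (hi : AffineIndependent ℝ ((↑) : τ → E3))
    (hc : τ.card = 4) {p x : E3}
    (h : ∀ i ∈ τ, 0 < baryCoord τ i p ∨
      baryCoord τ i p = 0 ∧ 0 ≤ (baryCoord τ i).linear x) :
    ∀ᶠ r : ℝ in 𝓝[>] 0, p + r • x ∈ convexHull ℝ (τ : Set E3) := by
  simp only [mem_convexHull_iff_baryCoord_nonneg hi hc]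
  rw [Filter.eventually_all_finset]
  intro i hiτ
  rcases h i hiτ with h | ⟨h0, h1⟩
  · filter_upwards [((continuous_baryCoord τ i).tendsto p |>.comp (tendsto_add_smul p x)).eventually
      (lt_mem_nhds h)] with r hr using le_of_lt hr
  · filter_upwards [self_mem_nhdsWithin] with r hr
    rw [baryCoord_add_smul, h0, zero_add]
    exact mul_nonneg (le_of_lt hr) h1

theorem eventually_baryCoord_pos {p x i : E3}
    (h : 0 < baryCoord τ i p ∨ baryCoord τ i p = 0 ∧ 0 < (baryCoord τ i).linear x) :
    ∀ᶠ r : ℝ in 𝓝[>] 0, 0 < baryCoord τ i (p + r • x) := by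
  rcases h with h | ⟨h0, h1⟩
  · exact ((continuous_baryCoord τ i).tendsto p |>.comp (tendsto_add_smul p x)).eventually
      (lt_mem_nhds h)
  · filter_upwards [self_mem_nhdsWithin] with r hr
    rw [baryCoord_add_smul, h0, zero_add]
    exact mul_pos hr h1

end Tetrahedron

/-! ### The tetrahedra around a face -/

section Mesh

variable {Ω : Set E3} {K : SimplicialComplex ℝ E3} {f : Finset E3} {p x : E3}

/-- `p` lies in the relative interior of the face `f` of the mesh: it belongs to the simplex `f`, and
its barycentric coordinates at the vertices of `f` are positive in every tetrahedron containing
`f`. -/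
structure IsRelInterior (K : SimplicialComplex ℝ E3) (f : Finset E3) (p : E3) : Prop where
  mem_convexHull : p ∈ convexHull ℝ (f : Set E3)
  baryCoord_pos : ∀ τ ∈ K.faces, τ.card = 4 → f ⊆ τ → ∀ i ∈ f, 0 < baryCoord τ i p

theorem IsRelInterior.baryCoord_eq_zero (hp : IsRelInterior K f p) {τ : Finset E3}
    (hτ : τ ∈ K.faces) (hc : τ.card = 4) (hf : f ⊆ τ) {i : E3} (hi : i ∈ τ) (hif : i ∉ f) :
    baryCoord τ i p = 0 :=
  baryCoord_eq_zero_of_mem_convexHull (K.indep hτ) hc (by exact_mod_cast hf) hp.mem_convexHull hi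
    (by simpa using hif)

/-- A simplex of the mesh that meets the relative interior of `f` contains `f`. -/
theorem IsRelInterior.subset (hK : IsTetrahedralMesh K Ω) (hfK : f ∈ K.faces)
    (hp : IsRelInterior K f p) {s : Finset E3} (hs : s ∈ K.faces)
    (hps : p ∈ convexHull ℝ (s : Set E3)) : f ⊆ s := by
  obtain ⟨τ, hτ, hfτ, hc⟩ := hK.pure f hfK
  intro i hi
  by_contra his
  have h1 := K.inter_subset_convexHull hfK hs ⟨hp.mem_convexHull, hps⟩
  have h2 := baryCoord_eq_zero_of_mem_convexHull (K.indep hτ) hc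
    (fun j hj => hfτ hj.1) h1 (hfτ hi) (fun h => his h.2)
  exact (hp.baryCoord_pos τ hτ hc hfτ i hi).ne' h2

/-- Every direction at an interior point of the mesh that is in the relative interior of `f` points
into the wedge of some tetrahedron containing `f`. -/
theorem exists_tetrahedron_of_direction (hK : IsTetrahedralMesh K Ω) (hfK : f ∈ K.faces)
    (hp : IsRelInterior K f p) (hint : K.space ∈ 𝓝 p) (x : E3) :
    ∃ τ ∈ K.faces, τ.card = 4 ∧ f ⊆ τ ∧ ∀ i ∈ τ, i ∉ f → 0 ≤ (baryCoord τ i).linear x := by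
  have h1 : ∀ᶠ r : ℝ in 𝓝[>] 0, p + r • x ∈ K.space := (tendsto_add_smul p x).eventually hint
  have h2 : ∀ᶠ r : ℝ in 𝓝[>] 0, ∀ s ∈ K.faces, ¬ f ⊆ s →
      p + r • x ∉ convexHull ℝ (s : Set E3) := by
    rw [hK.finite.eventually_all]
    intro s hs
    by_cases hfs : f ⊆ s
    · simp [hfs]
    have hcl : IsClosed (convexHull ℝ (s : Set E3)) := s.finite_toSet.isClosed_convexHull ℝ
    have hps : p ∉ convexHull ℝ (s : Set E3) := fun h => hfs (hp.subset hK hfK hs h)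
    filter_upwards [(tendsto_add_smul p x).eventually (hcl.isOpen_compl.mem_nhds hps)]
      with r hr _ using hr
  obtain ⟨r, ⟨hr1, hr2⟩, hr⟩ := ((h1.and h2).and self_mem_nhdsWithin).exists
  obtain ⟨s, hs, hxs⟩ := K.mem_space_iff.1 hr1
  have hfs : f ⊆ s := by
    by_contra h
    exact hr2 s hs h hxs
  obtain ⟨τ, hτ, hsτ, hc⟩ := hK.pure s hs
  refine ⟨τ, hτ, hc, hfs.trans hsτ, fun i hi hif => ?_⟩
  exact linear_nonneg_of_mem_convexHull (K.indep hτ) hc hr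
    (convexHull_mono (by exact_mod_cast hsτ) hxs) hi
    (hp.baryCoord_eq_zero hτ hc (hfs.trans hsτ) hi hif)

/-- A direction pointing into the interior of the wedge of `τ` at `f` lies in no other wedge at
`f`. -/
theorem eq_of_direction_mem_wedges (hp : IsRelInterior K f p)
    {τ σ : Finset E3} (hτ : τ ∈ K.faces) (hτc : τ.card = 4) (hfτ : f ⊆ τ)
    (hσ : σ ∈ K.faces) (hσc : σ.card = 4) (hfσ : f ⊆ σ)
    (hτx : ∀ i ∈ τ, i ∉ f → 0 < (baryCoord τ i).linear x)
    (hσx : ∀ i ∈ σ, i ∉ f → 0 ≤ (baryCoord σ i).linear x) : τ = σ := by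
  have key : ∀ i ∈ τ, 0 < baryCoord τ i p ∨
      baryCoord τ i p = 0 ∧ 0 < (baryCoord τ i).linear x := fun i hi => by
    by_cases hif : i ∈ f
    · exact .inl (hp.baryCoord_pos τ hτ hτc hfτ i hif)
    · exact .inr ⟨hp.baryCoord_eq_zero hτ hτc hfτ hi hif, hτx i hi hif⟩
  have h1 : ∀ᶠ r : ℝ in 𝓝[>] 0, ∀ i ∈ τ, 0 < baryCoord τ i (p + r • x) := by
    rw [Filter.eventually_all_finset]
    exact fun i hi => eventually_baryCoord_pos (key i hi)
  have h2 := eventually_mem_convexHull (x := x) (K.indep hσ) hσc fun i hi => by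
    by_cases hif : i ∈ f
    · exact .inl (hp.baryCoord_pos σ hσ hσc hfσ i hif)
    · exact .inr ⟨hp.baryCoord_eq_zero hσ hσc hfσ hi hif, hσx i hi hif⟩
  obtain ⟨r, hr1, hr2⟩ := (h1.and h2).exists
  have hr3 := (mem_convexHull_iff_baryCoord_nonneg (K.indep hτ) hτc).2 fun i hi => (hr1 i hi).le
  have h3 := K.inter_subset_convexHull hτ hσ ⟨hr3, hr2⟩
  refine Finset.eq_of_subset_of_card_le (fun i hi => ?_) (by omega)
  by_contra hiσ
  exact (hr1 i hi).ne' (baryCoord_eq_zero_of_mem_convexHull (K.indep hτ) hτc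
    Set.inter_subset_left h3 hi fun h => hiσ h.2)

theorem isRelInterior_singleton {v : E3} : IsRelInterior K {v} v where
  mem_convexHull := by simp
  baryCoord_pos τ hτ hc hf i hi := by
    obtain rfl := Finset.mem_singleton.1 hi
    simp [baryCoord_apply (K.indep hτ) hc (hf hi) (hf hi)]

theorem isRelInterior_pair {v u : E3} (huv : u ≠ v) {r : ℝ} (h0 : 0 < r) (h1 : r < 1) :
    IsRelInterior K {v, u} (v + r • (u - v)) where
  mem_convexHull := by
    have : v + r • (u - v) ∈ segment ℝ v u := by
      rw [segment_eq_image']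
      exact ⟨r, ⟨h0.le, h1.le⟩, rfl⟩
    simpa [convexHull_pair] using this
  baryCoord_pos τ hτ hc hf i hi := by
    have hv : v ∈ τ := hf (by simp)
    have hu : u ∈ τ := hf (by simp)
    rw [baryCoord_add_smul, baryCoord_linear_sub, baryCoord_apply (K.indep hτ) hc (hf hi) hv,
      baryCoord_apply (K.indep hτ) hc (hf hi) hu]
    rcases Finset.mem_insert.1 hi with rfl | hi
    · simp [huv.symm, h1]
    · obtain rfl := Finset.mem_singleton.1 hi
      simp [huv, h0]

end Mesh

/-! ### Counting signs in a generic direction -/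

section Count

/-- Among three nonzero numbers, count the ways to omit one so that the other two are positive, and
the ways to omit one so that the other two are negative. The total is three if all signs agree and one
otherwise. -/
theorem card_filter_pos_add_card_filter_neg {A : Finset E3} (hA : A.card = 3) (g : E3 → ℝ)
    (hg : ∀ i ∈ A, g i ≠ 0) [DecidableEq E3] :
    (A.filter fun u => ∀ w ∈ A, w ≠ u → 0 < g w).card +
      (A.filter fun u => ∀ w ∈ A, w ≠ u → g w < 0).card =
    1 + 2 * (if ∀ w ∈ A, 0 < g w then 1 else 0) + 2 * (if ∀ w ∈ A, g w < 0 then 1 else 0) := by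
  obtain ⟨a, b, c, hab, hac, hbc, rfl⟩ := Finset.card_eq_three.1 hA
  have ha := hg a (by simp)
  have hb := hg b (by simp)
  have hc := hg c (by simp)
  rcases ha.lt_or_gt with ha | ha <;> rcases hb.lt_or_gt with hb | hb <;>
    rcases hc.lt_or_gt with hc | hc <;>
    simp [Finset.filter_insert, Finset.filter_singleton, hab, hac, hbc, hab.symm, hac.symm,
      hbc.symm, ha, hb, hc, ha.not_gt, hb.not_gt, hc.not_gt]

variable {Ω : Set E3} {K : SimplicialComplex ℝ E3} {v : E3}

theorem vertexStar_finite (hK : IsTetrahedralMesh K Ω) (v : E3) : (vertexStar K v).Finite :=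
  hK.finite.subset fun _ h => h.1

theorem vertexStar_nonempty (hK : IsTetrahedralMesh K Ω) (hv : v ∈ K.vertices) :
    (vertexStar K v).Nonempty := by
  obtain ⟨τ, hτ, hvτ, hc⟩ := hK.pure {v} hv
  exact ⟨τ, hτ, hc, hvτ (by simp)⟩

/-- A direction in general position: parallel to no facet of a tetrahedron of the mesh. -/
def IsGeneric (K : SimplicialComplex ℝ E3) (x : E3) : Prop :=
  ∀ τ ∈ K.faces, τ.card = 4 → ∀ i ∈ τ, (baryCoord τ i).linear x ≠ 0

theorem IsGeneric.neg {x : E3} (hx : IsGeneric K x) : IsGeneric K (-x) :=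
  fun τ hτ hc i hi => by simpa using hx τ hτ hc i hi

/-- The interior of the wedge at the face `f` of a tetrahedron `τ` contains the direction `x`. -/
def MemWedge (τ f : Finset E3) (x : E3) : Prop :=
  ∀ w ∈ τ, w ∉ f → 0 < (baryCoord τ w).linear x

open Classical in
/-- A generic direction at an interior vertex lies in the wedge of exactly one of the tetrahedra
around a face through that vertex. -/
theorem card_filter_memWedge (hK : IsTetrahedralMesh K Ω) {f : Finset E3} (hfK : f ∈ K.faces)
    (hvf : v ∈ f) {p x : E3} (hp : IsRelInterior K f p) (hint : K.space ∈ 𝓝 p)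
    (hx : IsGeneric K x) :
    ((vertexStar_finite hK v).toFinset.filter fun τ => f ⊆ τ ∧ MemWedge τ f x).card = 1 := by
  obtain ⟨τ, hτ, hc, hfτ, h⟩ := exists_tetrahedron_of_direction hK hfK hp hint x
  rw [Finset.card_eq_one]
  refine ⟨τ, ?_⟩
  ext σ
  simp only [Finset.mem_filter, Set.Finite.mem_toFinset, Finset.mem_singleton]
  constructor
  · rintro ⟨⟨hσ, hσc, -⟩, hfσ, hσx⟩
    exact eq_of_direction_mem_wedges hp hσ hσc hfσ hτ hc hfτ hσx h
  · rintro rfl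
    exact ⟨⟨hτ, hc, hfτ hvf⟩, hfτ,
      fun w hw hwf => (h w hw hwf).lt_of_ne' (hx _ hτ hc w hw)⟩

open Classical in
theorem card_filter_memWedge_vertex (hK : IsTetrahedralMesh K Ω) (hv : v ∈ K.vertices)
    (hint : K.space ∈ 𝓝 v) {x : E3} (hx : IsGeneric K x) :
    ((vertexStar_finite hK v).toFinset.filter fun τ => MemWedge τ {v} x).card = 1 := by
  rw [← card_filter_memWedge hK hv (Finset.mem_singleton_self v) isRelInterior_singleton hint hx]
  congr 1
  refine Finset.filter_congr fun τ hτ => ?_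
  have : v ∈ τ := ((vertexStar_finite hK v).mem_toFinset.1 hτ).2.2
  simp [this]

open Classical in
theorem card_filter_memWedge_edge (hK : IsTetrahedralMesh K Ω) (hint : K.space ∈ 𝓝 v)
    {u : E3} (huv : u ≠ v) (hu : {v, u} ∈ K.faces) {x : E3} (hx : IsGeneric K x) :
    ((vertexStar_finite hK v).toFinset.filter fun τ => u ∈ τ ∧ MemWedge τ {v, u} x).card = 1 := by
  -- points of the open edge near `v` are interior points of the mesh
  have h1 : ∀ᶠ r : ℝ in 𝓝[>] 0, K.space ∈ 𝓝 (v + r • (u - v)) :=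
    (tendsto_add_smul v (u - v)).eventually (eventually_mem_nhds_iff.2 hint)
  have h2 : ∀ᶠ r : ℝ in 𝓝[>] 0, r < 1 := nhdsWithin_le_nhds (gt_mem_nhds one_pos)
  obtain ⟨r, ⟨hr1, hr2⟩, hr0⟩ := ((h1.and h2).and self_mem_nhdsWithin).exists
  rw [← card_filter_memWedge hK hu (Finset.mem_insert_self v _)
    (isRelInterior_pair huv hr0 hr2) hr1 hx]
  congr 1
  refine Finset.filter_congr fun τ hτ => ?_
  have : v ∈ τ := ((vertexStar_finite hK v).mem_toFinset.1 hτ).2.2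
  simp [Finset.insert_subset_iff, this]

theorem ncard_vertexEdges [DecidableEq E3] (K : SimplicialComplex ℝ E3) (v : E3) :
    (vertexEdges K v).ncard = {u | u ≠ v ∧ {v, u} ∈ K.faces}.ncard := by
  have : vertexEdges K v = (fun u => ({v, u} : Finset E3)) '' {u | u ≠ v ∧ {v, u} ∈ K.faces} := by
    ext s
    constructor
    · rintro ⟨hs, hc, hv⟩
      obtain ⟨u, hu⟩ := Finset.card_eq_one.1 (show (s.erase v).card = 1 by
        rw [Finset.card_erase_of_mem hv, hc])
      have hs' : {v, u} = s := by rw [← Finset.insert_erase hv, hu]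
      have huv : u ≠ v := Finset.ne_of_mem_erase (hu ▸ Finset.mem_singleton_self u)
      exact ⟨u, ⟨huv, hs' ▸ hs⟩, hs'⟩
    · rintro ⟨u, ⟨huv, hu⟩, rfl⟩
      exact ⟨hu, Finset.card_pair huv.symm, by simp⟩
  rw [this, Set.InjOn.ncard_image]
  intro u hu w _ huw
  have : u ∈ ({v, w} : Finset E3) := by
    have h : ({v, u} : Finset E3) = {v, w} := huw
    rw [← h]; simp
  simpa [hu.1] using this

open Classical in
/-- Double count of the pairs of a tetrahedron at `v` and an edge of it through `v` whose wedge
contains a given generic direction: every edge contributes one pair. -/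
theorem sum_card_filter_memWedge_edge (hK : IsTetrahedralMesh K Ω) (hint : K.space ∈ 𝓝 v)
    {x : E3} (hx : IsGeneric K x) :
    ∑ τ ∈ (vertexStar_finite hK v).toFinset,
      ((τ.erase v).filter fun u => MemWedge τ {v, u} x).card = (vertexEdges K v).ncard := by
  have hfin : {u | u ≠ v ∧ {v, u} ∈ K.faces}.Finite := by
    refine (hK.finite.biUnion fun s _ => s.finite_toSet).subset fun u hu => ?_
    exact Set.mem_biUnion hu.2 (by simp)
  rw [ncard_vertexEdges, Set.ncard_eq_toFinset_card _ hfin, Finset.card_eq_sum_ones]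
  have h1 : ∀ u ∈ hfin.toFinset, 1 = ((vertexStar_finite hK v).toFinset.filter
      fun τ => u ∈ τ ∧ MemWedge τ {v, u} x).card := fun u hu => by
    obtain ⟨huv, hu⟩ := hfin.mem_toFinset.1 hu
    exact (card_filter_memWedge_edge hK hint huv hu hx).symm
  rw [Finset.sum_congr rfl h1]
  refine Eq.trans ?_ (Finset.sum_card_bipartiteAbove_eq_sum_card_bipartiteBelow
    fun τ u => u ∈ τ ∧ MemWedge τ {v, u} x)
  refine Finset.sum_congr rfl fun τ hτ => ?_
  obtain ⟨hτK, -, hvτ⟩ := (vertexStar_finite hK v).mem_toFinset.1 hτ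
  congr 1
  ext u
  simp only [Finset.mem_filter, Finset.mem_erase, Finset.bipartiteAbove, Set.Finite.mem_toFinset,
    Set.mem_ofPred_eq]
  constructor
  · rintro ⟨⟨huv, hu⟩, h⟩
    refine ⟨⟨huv, K.down_closed hτK ?_ (by simp)⟩, hu, h⟩
    simp [Finset.insert_subset_iff, hvτ, hu]
  · rintro ⟨⟨huv, -⟩, hu, h⟩
    exact ⟨⟨huv, hu⟩, h⟩

/-- Almost every direction is generic. -/
theorem ae_isGeneric (hK : IsTetrahedralMesh K Ω) : ∀ᵐ x : E3, IsGeneric K x := by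
  unfold IsGeneric
  rw [ae_ball_iff hK.finite.countable]
  intro τ hτ
  by_cases hc : τ.card = 4
  swap
  · simp [hc]
  simp only [hc, true_imp_iff]
  rw [Filter.eventually_all_finset]
  intro i hi
  have h := Measure.addHaar_submodule (volume : Measure E3) (LinearMap.ker (baryCoord τ i).linear)
    (by simpa [LinearMap.ker_eq_top] using baryCoord_linear_ne_zero (K.indep hτ) hc hi)
  rw [ae_iff]
  convert h using 2
  ext
  simp

/-- Euler's relation for the link of an interior vertex: the `t` triangles of the link and its `e`
vertices satisfy `2 * e = t + 4`. -/
theorem two_mul_ncard_vertexEdges (hK : IsTetrahedralMesh K Ω) (hv : v ∈ K.vertices)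
    (hint : K.space ∈ 𝓝 v) :
    2 * (vertexEdges K v).ncard = (vertexStar K v).ncard + 4 := by
  classical
  obtain ⟨x, hx⟩ := (ae_isGeneric hK).exists
  have hS := vertexStar_finite hK v
  have h1 := sum_card_filter_memWedge_edge hK hint hx
  have h2 := sum_card_filter_memWedge_edge hK hint hx.neg
  have h3 := card_filter_memWedge_vertex hK hv hint hx
  have h4 := card_filter_memWedge_vertex hK hv hint hx.neg
  have key : ∀ τ ∈ hS.toFinset,
      ((τ.erase v).filter fun u => MemWedge τ {v, u} x).card +
        ((τ.erase v).filter fun u => MemWedge τ {v, u} (-x)).card =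
      1 + 2 * (if MemWedge τ {v} x then 1 else 0) + 2 * (if MemWedge τ {v} (-x) then 1 else 0) := by
    intro τ hτ
    obtain ⟨hτK, hc, hvτ⟩ := hS.mem_toFinset.1 hτ
    have h := card_filter_pos_add_card_filter_neg (A := τ.erase v)
      (by rw [Finset.card_erase_of_mem hvτ, hc]) (fun w => (baryCoord τ w).linear x)
      (fun w hw => hx τ hτK hc w (Finset.mem_of_mem_erase hw))
    convert h using 6 <;>
      simp only [MemWedge, Finset.mem_erase, Finset.mem_insert, Finset.mem_singleton, map_neg,
        Left.neg_pos_iff, not_or] <;> grind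
  have hsum := Finset.sum_congr rfl key
  rw [Finset.sum_add_distrib, h1, h2, Finset.sum_add_distrib, Finset.sum_add_distrib,
    ← Finset.mul_sum, ← Finset.mul_sum, Finset.sum_boole, Finset.sum_boole, h3, h4,
    ← Finset.card_eq_sum_ones, ← Set.ncard_eq_toFinset_card _ hS] at hsum
  simp only [Nat.cast_one] at hsum
  omega

end Count

/-! ### Solid angles -/

section SolidAngle

variable {Ω : Set E3} {K : SimplicialComplex ℝ E3} {v : E3} {τ : Finset E3}

/-- The unit vectors pointing from the vertex `v` into the tetrahedron `τ` form the intersection of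
three closed half-spheres. -/
theorem exists_smul_mem_convexHull_iff (hi : AffineIndependent ℝ ((↑) : τ → E3)) (hc : τ.card = 4)
    (hv : v ∈ τ) {x : E3} :
    (∃ r : ℝ, 0 < r ∧ v + r • x ∈ convexHull ℝ (τ : Set E3)) ↔
      ∀ i ∈ τ, i ≠ v → 0 ≤ (baryCoord τ i).linear x := by
  constructor
  · rintro ⟨r, hr, hx⟩ i hiτ hiv
    exact linear_nonneg_of_mem_convexHull hi hc hr hx hiτ
      (by simp [baryCoord_apply hi hc hiτ hv, hiv])
  · intro h
    have h1 := eventually_mem_convexHull (p := v) (x := x) hi hc fun i hiτ => by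
      by_cases hiv : i = v
      · exact .inl (by rw [baryCoord_apply hi hc hiτ hv]; simp [hiv])
      · simp [baryCoord_apply hi hc hiτ hv, hiv, h i hiτ hiv]
    obtain ⟨r, hr1, hr0⟩ := (h1.and self_mem_nhdsWithin).exists
    exact ⟨r, hr0, hr1⟩

/-- The region of the unit sphere whose area is the solid angle of `τ` at `v`. -/
def angleRegion (τ : Finset E3) (v : E3) : Set (Metric.sphere (0 : E3) 1) :=
  {u | ∃ r : ℝ, 0 < r ∧ v + r • (u : E3) ∈ convexHull ℝ (τ : Set E3)}

theorem continuous_linear_baryCoord (τ : Finset E3) (i : E3) :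
    Continuous (baryCoord τ i).linear :=
  (baryCoord τ i).linear.continuous_of_finiteDimensional

theorem isClosed_angleRegion (hi : AffineIndependent ℝ ((↑) : τ → E3)) (hc : τ.card = 4)
    (hv : v ∈ τ) : IsClosed (angleRegion τ v) := by
  simp only [angleRegion, exists_smul_mem_convexHull_iff hi hc hv, Set.ofPred_forall]
  exact isClosed_iInter fun i => isClosed_iInter fun _ => isClosed_iInter fun _ =>
    isClosed_le continuous_const
      ((continuous_linear_baryCoord τ i).comp continuous_subtype_val)

theorem solidAngle_pos (hi : AffineIndependent ℝ ((↑) : τ → E3)) (hc : τ.card = 4)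
    (hv : v ∈ τ) : 0 < solidAngle τ v := by
  -- the sum of the edge vectors at `v` has all relevant coordinates equal to one
  have hx0 : ∀ i ∈ τ, i ≠ v → (baryCoord τ i).linear (∑ j ∈ τ, (j - v)) = 1 := by
    intro i hiτ hiv
    rw [map_sum, Finset.sum_eq_single_of_mem i hiτ]
    · simp [baryCoord_linear_sub, baryCoord_apply hi hc hiτ hiτ, baryCoord_apply hi hc hiτ hv, hiv]
    · intro j hj hji
      simp [baryCoord_linear_sub, baryCoord_apply hi hc hiτ hj, baryCoord_apply hi hc hiτ hv, hiv,
        hji.symm]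
  set x := ∑ j ∈ τ, (j - v) with hx
  have hxne : x ≠ 0 := by
    obtain ⟨j, hj, hjv⟩ := Finset.exists_mem_ne (by omega : 1 < τ.card) v
    intro h
    simpa [h] using hx0 j hj hjv
  let U : Set (Metric.sphere (0 : E3) 1) :=
    ⋂ i ∈ τ, {u | i ≠ v → 0 < (baryCoord τ i).linear u}
  have hU : IsOpen U := isOpen_biInter_finset fun i _ => by
    by_cases hiv : i = v
    · simp [hiv]
    · simp only [ne_eq, hiv, not_false_eq_true, true_imp_iff]
      exact isOpen_lt continuous_const
        ((continuous_linear_baryCoord τ i).comp continuous_subtype_val)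
  have hne : U.Nonempty := by
    refine ⟨⟨‖x‖⁻¹ • x, by simp [norm_smul, hxne]⟩, ?_⟩
    simp only [U, Set.mem_iInter, Set.mem_ofPred_eq]
    intro i hiτ hiv
    rw [map_smul, hx0 i hiτ hiv]
    simpa using hxne
  have hsub : U ⊆ angleRegion τ v := fun u hu => by
    refine (exists_smul_mem_convexHull_iff hi hc hv).2 fun i hiτ hiv => ?_
    exact (Set.mem_iInter₂.1 hu i hiτ hiv).le
  have hpos : 0 < (volume : Measure E3).toSphere.real U :=
    ENNReal.toReal_pos (hU.measure_pos _ hne).ne' (measure_ne_top _ _)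
  exact hpos.trans_le (measureReal_mono hsub)

/-- A great circle has area zero. -/
theorem toSphere_linear_eq_zero (L : E3 →ₗ[ℝ] ℝ) (hL : L ≠ 0) :
    (volume : Measure E3).toSphere {u | L u = 0} = 0 := by
  have hc : Continuous L := L.continuous_of_finiteDimensional
  have hcl : IsClosed {u : Metric.sphere (0 : E3) 1 | L u = 0} :=
    isClosed_eq (hc.comp continuous_subtype_val) continuous_const
  rw [Measure.toSphere_apply' _ hcl.measurableSet]
  have h := Measure.addHaar_submodule (volume : Measure E3) (LinearMap.ker L)
    (by simpa [LinearMap.ker_eq_top] using hL)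
  rw [measure_mono_null _ h, mul_zero]
  rintro _ ⟨r, -, _, ⟨u, hu, rfl⟩, rfl⟩
  simp only [Set.mem_ofPred_eq] at hu
  simp [hu]

theorem toSphere_real_univ_eq : (volume : Measure E3).toSphere.real Set.univ = 4 * Real.pi := by
  rw [Measure.toSphere_real_apply_univ, measureReal_def, EuclideanSpace.volume_ball_fin_three]
  have := Real.pi_pos
  simp only [finrank_euclideanSpace, Fintype.card_fin, ENNReal.ofReal_one, one_pow, one_mul]
  rw [ENNReal.toReal_ofReal (by positivity)]
  push_cast
  ring

/-- Two solid angles at `v` overlap only along great circles, since a common generic direction would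
lie in the cones of two different tetrahedra. -/
theorem aedisjoint_angleRegion {σ : Finset E3} (hτ : τ ∈ vertexStar K v) (hσ : σ ∈ vertexStar K v)
    (hne : τ ≠ σ) :
    AEDisjoint (volume : Measure E3).toSphere (angleRegion τ v) (angleRegion σ v) := by
  obtain ⟨hτK, hτc, hvτ⟩ := hτ
  obtain ⟨hσK, hσc, hvσ⟩ := hσ
  have h0 : (volume : Measure E3).toSphere (⋃ i ∈ τ, {u | (baryCoord τ i).linear u = 0}) = 0 :=
    (measure_biUnion_null_iff τ.countable_toSet).2 fun i hi =>
      toSphere_linear_eq_zero _ (baryCoord_linear_ne_zero (K.indep hτK) hτc hi)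
  refine measure_mono_null (fun u hu => ?_) h0
  by_contra hu0
  simp only [Set.mem_iUnion, Set.mem_ofPred_eq, not_exists] at hu0
  have h1 := (exists_smul_mem_convexHull_iff (K.indep hτK) hτc hvτ).1 hu.1
  have h2 := (exists_smul_mem_convexHull_iff (K.indep hσK) hσc hvσ).1 hu.2
  refine hne (eq_of_direction_mem_wedges (f := {v}) (x := u) isRelInterior_singleton hτK hτc
    (by simpa using hvτ) hσK hσc (by simpa using hvσ) (fun i hi hiv => ?_) fun i hi hiv => ?_)
  · exact (h1 i hi (by simpa using hiv)).lt_of_ne' (hu0 i hi)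
  · exact h2 i hi (by simpa using hiv)

/-- The solid angles around an interior vertex add up to the full sphere. -/
theorem finsum_solidAngle (hK : IsTetrahedralMesh K Ω) (hv : v ∈ K.vertices)
    (hint : K.space ∈ 𝓝 v) : ∑ᶠ τ ∈ vertexStar K v, solidAngle τ v = 4 * Real.pi := by
  have hS := vertexStar_finite hK v
  rw [finsum_mem_eq_finite_toFinset_sum _ hS, ← toSphere_real_univ_eq]
  have hcover : (⋃ τ ∈ hS.toFinset, angleRegion τ v) = Set.univ := by
    refine Set.eq_univ_of_forall fun u => ?_
    obtain ⟨τ, hτ, hc, hvτ, h⟩ :=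
      exists_tetrahedron_of_direction hK hv isRelInterior_singleton hint (u : E3)
    have hvτ : v ∈ τ := by simpa using hvτ
    refine Set.mem_iUnion₂.2 ⟨τ, hS.mem_toFinset.2 ⟨hτ, hc, hvτ⟩, ?_⟩
    exact (exists_smul_mem_convexHull_iff (K.indep hτ) hc hvτ).2
      fun i hi hiv => h i hi (by simpa using hiv)
  rw [← hcover, measureReal_biUnion_finset₀]
  · rfl
  · exact fun τ hτ σ hσ hne =>
      aedisjoint_angleRegion (hS.mem_toFinset.1 hτ) (hS.mem_toFinset.1 hσ) hne
  · intro τ hτ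
    obtain ⟨hτK, hc, hvτ⟩ := hS.mem_toFinset.1 hτ
    exact (isClosed_angleRegion (K.indep hτK) hc hvτ).measurableSet.nullMeasurableSet

theorem minSolidAngleAt_pos (hK : IsTetrahedralMesh K Ω) (hv : v ∈ K.vertices) :
    0 < minSolidAngleAt K v := by
  obtain ⟨τ, ⟨hτ, hc, hvτ⟩, h⟩ := ((vertexStar_nonempty hK hv).image _).csInf_mem
    ((vertexStar_finite hK v).image fun τ => solidAngle τ v)
  exact (solidAngle_pos (K.indep hτ) hc hvτ).trans_eq h

theorem minSolidAngleAt_le (hK : IsTetrahedralMesh K Ω) (hτ : τ ∈ vertexStar K v) :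
    minSolidAngleAt K v ≤ solidAngle τ v :=
  csInf_le ((vertexStar_finite hK v).image fun τ => solidAngle τ v).bddBelow
    (Set.mem_image_of_mem _ hτ)

theorem minSolidAngleAt_le_meanSolidAngle (hK : IsTetrahedralMesh K Ω) (hv : v ∈ K.vertices) :
    minSolidAngleAt K v ≤ meanSolidAngle K v := by
  have hS := vertexStar_finite hK v
  have ht : 0 < ((vertexStar K v).ncard : ℝ) := by
    exact_mod_cast (Set.ncard_pos hS).2 (vertexStar_nonempty hK hv)
  rw [meanSolidAngle, finsum_mem_eq_finite_toFinset_sum _ hS, one_div, ← div_eq_inv_mul,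
    le_div_iff₀ ht, mul_comm, Set.ncard_eq_toFinset_card _ hS, ← nsmul_eq_mul]
  exact Finset.card_nsmul_le_sum _ _ _ fun τ hτ => minSolidAngleAt_le hK (hS.mem_toFinset.1 hτ)

theorem vertices_finite (hK : IsTetrahedralMesh K Ω) : K.vertices.Finite := by
  rw [K.vertices_eq]
  exact hK.finite.biUnion fun s _ => s.finite_toSet

theorem minSolidAngle_pos (hK : IsTetrahedralMesh K Ω) (hne : K.vertices.Nonempty) :
    0 < minSolidAngle K := by
  obtain ⟨v, hv, h⟩ := (hne.image _).csInf_mem ((vertices_finite hK).image (minSolidAngleAt K))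
  exact (minSolidAngleAt_pos hK hv).trans_eq h

theorem minSolidAngle_le (hK : IsTetrahedralMesh K Ω) (hv : v ∈ K.vertices) :
    minSolidAngle K ≤ minSolidAngleAt K v :=
  csInf_le ((vertices_finite hK).image _).bddBelow (Set.mem_image_of_mem _ hv)

end SolidAngle

/-! ### The number of edges at an interior vertex -/

theorem mainTheorem6 (Ω : Set E3) (hΩ : IsOpen Ω) (hΩb : Bornology.IsBounded Ω)
    (K : Geometry.SimplicialComplex ℝ E3) (hK : IsTetrahedralMesh K Ω)
    (v : E3) (hv : v ∈ K.vertices) (hint : v ∉ frontier Ω) :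
    ((vertexEdges K v).ncard : ℝ) = 2 + 2 * Real.pi / meanSolidAngle K v ∧
      2 + 2 * Real.pi / meanSolidAngle K v ≤ 2 + 2 * Real.pi / minSolidAngleAt K v ∧
      2 + 2 * Real.pi / minSolidAngleAt K v ≤ 2 + 2 * Real.pi / minSolidAngle K := by
  have hpi := Real.pi_pos
  -- the vertex lies in the closure of `Ω` but not on its frontier, hence in the open set `Ω`
  have hnhds : K.space ∈ 𝓝 v := by
    have hvcl : v ∈ closure Ω := hK.space_eq ▸ K.vertices_subset_space hv
    have hvΩ : v ∈ Ω := by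
      rw [hΩ.frontier_eq] at hint
      by_contra h
      exact hint ⟨hvcl, h⟩
    rw [hK.space_eq]
    exact mem_of_superset (hΩ.mem_nhds hvΩ) subset_closure
  refine ⟨?_, ?_, ?_⟩
  · have ht : ((vertexStar K v).ncard : ℝ) ≠ 0 := by
      exact_mod_cast ((Set.ncard_pos (vertexStar_finite hK v)).2 (vertexStar_nonempty hK hv)).ne'
    have he : 2 * ((vertexEdges K v).ncard : ℝ) = (vertexStar K v).ncard + 4 := by
      exact_mod_cast two_mul_ncard_vertexEdges hK hv hnhds
    rw [meanSolidAngle, finsum_solidAngle hK hv hnhds]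
    field_simp
    linarith
  · have := minSolidAngleAt_pos hK hv
    have := minSolidAngleAt_le_meanSolidAngle hK hv
    gcongr
  · have := minSolidAngle_pos hK ⟨v, hv⟩
    have := minSolidAngle_le hK hv
    gcongr
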